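/- For a positive integer $n$ let $G(n)$ be the bipartite graph with vertices $x_1,\dots,x_n,y_1,\dots,y_n$ whose edges are the pairs $x_iy_j$ with $i\le j$. A (monotone Boolean) formula is built from variables by the operations $+$ (or) and $*$ (and), without constants; it is read-$k$ if no variable occurs in it more than $k$ times. Expanding a formula by distributivity and idempotency into a sum of products of distinct variables, and deleting every product that properly contains another one, leaves its minterms. A formula in the variables $x_1,\dots,x_n,y_1,\dots,y_n$ is an extension of $G(n)$ if its minterms are all the products $x_i*y_j$ with $1\le i\le j\le n$ and, in addition, zero or more terms each of which is a product of two or more distinct $x$-variables or a product of two or more distinct $y$-variables. Let $n\ge 1$ and $k\ge 1$. If $G(n)$ has no read-$(k-1)$ extension, then there exists $m>n$ such that $G(m)$ has no read-$k$ extension. Moreover, in that case $G(m)$ has no read-$k$ extension for every $m\ge 2nk^k$. -/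

import Mathlib

/-- Monotone Boolean formulas over the variables `α`, built from variables with `+` (disjunction)
and `*` (conjunction); there are no constants. -/
inductive MonotoneFormula (α : Type) : Type
  | var (a : α) : MonotoneFormula α
  | add (φ ψ : MonotoneFormula α) : MonotoneFormula α
  | mul (φ ψ : MonotoneFormula α) : MonotoneFormula α

namespace MonotoneFormula

variable {α : Type} [DecidableEq α]

/-- The number of occurrences of the variable `a` in a formula. -/
def occurrences (a : α) : MonotoneFormula α → ℕ
  | var b => if b = a then 1 else 0
  | add φ ψ => occurrences a φ + occurrences a ψ
  | mul φ ψ => occurrences a φ + occurrences a ψ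

/-- A formula is read-`k` if no variable occurs in it more than `k` times. -/
def IsRead (k : ℕ) (φ : MonotoneFormula α) : Prop :=
  ∀ a : α, occurrences a φ ≤ k

/-- The terms of the complete sum of products, obtained by distributivity and idempotency.
A term, i.e. a product of distinct variables, is identified with its set of variables. -/
def csop : MonotoneFormula α → Finset (Finset α)
  | var a => {{a}}
  | add φ ψ => csop φ ∪ csop ψ
  | mul φ ψ => Finset.image₂ (fun s t => s ∪ t) (csop φ) (csop ψ)

/-- The minterms of a formula: the terms of the complete sum of products that remain after
absorption, i.e. that contain no other term. -/
def sop (φ : MonotoneFormula α) : Finset (Finset α) :=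
  (csop φ).filter fun t => ∀ s ∈ csop φ, s ⊆ t → s = t

end MonotoneFormula

/-- The bipartite chain graph `G(n)`. The vertices `x₁, …, xₙ` are `Sum.inl i` and the vertices
`y₁, …, yₙ` are `Sum.inr j` (with indices shifted to start at `0`); the edges are the pairs
`xᵢ yⱼ` with `i ≤ j`. -/
def chainGraph (n : ℕ) : SimpleGraph (Fin n ⊕ Fin n) where
  Adj u v := ∃ i j : Fin n, i ≤ j ∧
    ((u = Sum.inl i ∧ v = Sum.inr j) ∨ (u = Sum.inr j ∧ v = Sum.inl i))
  symm := ⟨by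
    rintro u v ⟨i, j, hij, h | h⟩
    · exact ⟨i, j, hij, Or.inr ⟨h.2, h.1⟩⟩
    · exact ⟨i, j, hij, Or.inl ⟨h.2, h.1⟩⟩⟩
  loopless := ⟨by
    rintro u ⟨i, j, -, ⟨h, h'⟩ | ⟨h, h'⟩⟩
    · exact Sum.inl_ne_inr (h.symm.trans h')
    · exact Sum.inl_ne_inr (h'.symm.trans h)⟩

/-- A formula is an extension of `G(n)` if its minterms are all the edges of `G(n)` and, in
addition, zero or more terms each of which is a product of two or more `x` variables or of two or
more `y` variables. -/
def IsExtension (n : ℕ) (φ : MonotoneFormula (Fin n ⊕ Fin n)) : Prop :=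
  (∀ u v, (chainGraph n).Adj u v → {u, v} ∈ φ.sop) ∧
  ∀ t ∈ φ.sop,
    (∃ u v, (chainGraph n).Adj u v ∧ t = {u, v}) ∨
    (2 ≤ t.card ∧ ∀ v ∈ t, v.isLeft = true) ∨
    (2 ≤ t.card ∧ ∀ v ∈ t, v.isRight = true)

/-- `G(n)` has a read-`k` extension. -/
def HasReadExtension (n k : ℕ) : Prop :=
  ∃ φ : MonotoneFormula (Fin n ⊕ Fin n), IsExtension n φ ∧ φ.IsRead k

/-! Take a read-k extension of G(m). The smallest x-variable is adjacent to every y, and each of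
these edges needs an occurrence of it to meet, at some product, a factor true at y alone. At most k
such factors suffice (`exists_covering_reducts`), so by pigeonhole one factor w is true at many
single y's. Delete w and keep only those indices. Whenever a kept y is true, so is w, and the
function is unchanged; otherwise only x's are true, and new products of x's are harmless. Each kept
y occurs in w, so it loses an occurrence (`RepresentsExtension.exists_reduced`). Reversing the graph
and repeating saves an occurrence of every x as well. -/

namespace MonotoneFormula

/-! ### Truth values and minterms -/

/-- The truth value of a formula when exactly the variables in `S` are true. -/
def Eval {α : Type} (S : Set α) : MonotoneFormula α → Prop
  | var a => a ∈ S
  | add φ ψ => Eval S φ ∨ Eval S ψ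
  | mul φ ψ => Eval S φ ∧ Eval S ψ

theorem Eval.mono {α : Type} {S T : Set α} (h : S ⊆ T) {φ : MonotoneFormula α} (hφ : Eval S φ) :
    Eval T φ := by
  induction φ with
  | var a => exact h hφ
  | add φ ψ ihφ ihψ => exact hφ.imp ihφ ihψ
  | mul φ ψ ihφ ihψ => exact hφ.imp ihφ ihψ

variable {α β : Type} [DecidableEq α] [DecidableEq β]

theorem eval_iff_exists_mem_csop {S : Set α} {φ : MonotoneFormula α} :
    Eval S φ ↔ ∃ t ∈ φ.csop, (t : Set α) ⊆ S := by
  induction φ with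
  | var a => simp [Eval, csop]
  | add φ ψ ihφ ihψ => simp only [Eval, csop, ihφ, ihψ, Finset.mem_union]; grind
  | mul φ ψ ihφ ihψ =>
    simp only [Eval, csop, ihφ, ihψ, Finset.mem_image₂]
    constructor
    · rintro ⟨⟨s, hs, hsS⟩, t, ht, htS⟩
      exact ⟨s ∪ t, ⟨s, hs, t, ht, rfl⟩, by simp [hsS, htS]⟩
    · rintro ⟨_, ⟨s, hs, t, ht, rfl⟩, h⟩
      rw [Finset.coe_union, Set.union_subset_iff] at h
      exact ⟨⟨s, hs, h.1⟩, t, ht, h.2⟩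

theorem eval_of_mem_csop {t : Finset α} {φ : MonotoneFormula α} (ht : t ∈ φ.csop) :
    Eval (t : Set α) φ :=
  eval_iff_exists_mem_csop.2 ⟨t, ht, subset_rfl⟩

theorem mem_sop_iff {t : Finset α} {φ : MonotoneFormula α} :
    t ∈ φ.sop ↔ t ∈ φ.csop ∧ ∀ s ∈ φ.csop, s ⊆ t → s = t :=
  Finset.mem_filter

theorem mem_csop_of_mem_sop {t : Finset α} {φ : MonotoneFormula α} (ht : t ∈ φ.sop) :
    t ∈ φ.csop :=
  (mem_sop_iff.1 ht).1

theorem eq_of_mem_sop {s t : Finset α} {φ : MonotoneFormula α} (ht : t ∈ φ.sop)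
    (hs : s ∈ φ.csop) (hst : s ⊆ t) : s = t :=
  (mem_sop_iff.1 ht).2 s hs hst

theorem exists_mem_sop_of_eval {S : Set α} {φ : MonotoneFormula α} (h : Eval S φ) :
    ∃ t ∈ φ.sop, (t : Set α) ⊆ S := by
  obtain ⟨t, ht, htS⟩ := eval_iff_exists_mem_csop.1 h
  obtain ⟨s, hst, hs⟩ := φ.csop.exists_le_minimal ht
  refine ⟨s, mem_sop_iff.2 ⟨hs.prop, fun r hr hrs => ?_⟩, fun a ha => htS (hst ha)⟩
  exact le_antisymm hrs (hs.le_of_le hr hrs)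

theorem occurrences_pos_of_eval {a : α} {φ : MonotoneFormula α} (h : Eval {a} φ) :
    0 < occurrences a φ := by
  induction φ with
  | var b => simp [occurrences, show b = a from h]
  | add φ ψ ihφ ihψ =>
    simp only [occurrences]
    rcases h with h | h
    · have := ihφ h; omega
    · have := ihψ h; omega
  | mul φ ψ ihφ ihψ =>
    simp only [occurrences]
    have := ihφ h.1
    omega

/-! ### Restriction and dropping a factor -/

/-- Setting all variables outside the range of an injection `e` to false and renaming the others
leaves the constant false or a formula that reads no variable more often. -/
theorem exists_restriction (e : β → α) (he : Function.Injective e) (φ : MonotoneFormula α) :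
    (∀ S : Set β, ¬ Eval (e '' S) φ) ∨
      ∃ ψ : MonotoneFormula β, (∀ S, Eval S ψ ↔ Eval (e '' S) φ) ∧
        ∀ b, occurrences b ψ ≤ occurrences (e b) φ := by
  induction φ with
  | var a =>
    by_cases ha : ∃ b, e b = a
    · obtain ⟨b, rfl⟩ := ha
      refine Or.inr ⟨var b, fun S => (he.mem_set_image).symm, fun c => ?_⟩
      simp [occurrences, he.eq_iff]
    · exact Or.inl fun S ⟨b, _, hb⟩ => ha ⟨b, hb⟩
  | add φ₁ φ₂ ih₁ ih₂ =>
    rcases ih₁ with h₁ | ⟨ψ₁, h₁, o₁⟩ <;> rcases ih₂ with h₂ | ⟨ψ₂, h₂, o₂⟩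
    · exact Or.inl fun S => by simp [Eval, h₁, h₂]
    · exact Or.inr ⟨ψ₂, fun S => by simp [Eval, h₁, h₂], fun b => le_add_left (o₂ b)⟩
    · exact Or.inr ⟨ψ₁, fun S => by simp [Eval, h₁, h₂], fun b => le_add_right (o₁ b)⟩
    · exact Or.inr ⟨add ψ₁ ψ₂, fun S => by simp [Eval, h₁, h₂],
        fun b => add_le_add (o₁ b) (o₂ b)⟩
  | mul φ₁ φ₂ ih₁ ih₂ =>
    rcases ih₁ with h₁ | ⟨ψ₁, h₁, o₁⟩
    · exact Or.inl fun S => by simp [Eval, h₁]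
    rcases ih₂ with h₂ | ⟨ψ₂, h₂, o₂⟩
    · exact Or.inl fun S => by simp [Eval, h₂]
    · exact Or.inr ⟨mul ψ₁ ψ₂, fun S => by simp [Eval, h₁, h₂],
        fun b => add_le_add (o₁ b) (o₂ b)⟩

/-- `p.1` arises from `φ` by dropping the factor `p.2`: it lies above `φ`, agrees with `φ` wherever
`p.2` is true, and the occurrences in `p.2` are saved. -/
structure IsReduct (φ : MonotoneFormula α) (p : MonotoneFormula α × MonotoneFormula α) :
    Prop where
  le : ∀ S, Eval S φ → Eval S p.1
  ge : ∀ S, Eval S p.1 → Eval S p.2 → Eval S φ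
  occurrences_le : ∀ a, occurrences a p.1 + occurrences a p.2 ≤ occurrences a φ

theorem IsReduct.add_left {φ : MonotoneFormula α} {p} (h : IsReduct φ p) (χ : MonotoneFormula α) :
    IsReduct (add φ χ) (add p.1 χ, p.2) where
  le S := Or.imp_left (h.le S)
  ge S h₁ h₂ := h₁.imp_left fun h₁ => h.ge S h₁ h₂
  occurrences_le a := by have := h.occurrences_le a; simp only [occurrences]; omega

theorem IsReduct.add_right {φ : MonotoneFormula α} {p} (h : IsReduct φ p)
    (χ : MonotoneFormula α) : IsReduct (add χ φ) (add χ p.1, p.2) where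
  le S := Or.imp_right (h.le S)
  ge S h₁ h₂ := h₁.imp_right fun h₁ => h.ge S h₁ h₂
  occurrences_le a := by have := h.occurrences_le a; simp only [occurrences]; omega

theorem IsReduct.mul_left {φ : MonotoneFormula α} {p} (h : IsReduct φ p) (χ : MonotoneFormula α) :
    IsReduct (mul φ χ) (mul p.1 χ, p.2) where
  le S := And.imp_left (h.le S)
  ge S h₁ h₂ := h₁.imp_left fun h₁ => h.ge S h₁ h₂
  occurrences_le a := by have := h.occurrences_le a; simp only [occurrences]; omega

theorem IsReduct.mul_right {φ : MonotoneFormula α} {p} (h : IsReduct φ p)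
    (χ : MonotoneFormula α) : IsReduct (mul χ φ) (mul χ p.1, p.2) where
  le S := And.imp_right (h.le S)
  ge S h₁ h₂ := h₁.imp_right fun h₁ => h.ge S h₁ h₂
  occurrences_le a := by have := h.occurrences_le a; simp only [occurrences]; omega

theorem isReduct_left (φ χ : MonotoneFormula α) : IsReduct (mul φ χ) (φ, χ) where
  le _ h := h.1
  ge _ h₁ h₂ := ⟨h₁, h₂⟩
  occurrences_le _ := le_rfl

theorem isReduct_right (φ χ : MonotoneFormula α) : IsReduct (mul φ χ) (χ, φ) where
  le _ h := h.2
  ge _ h₁ h₂ := ⟨h₂, h₁⟩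
  occurrences_le _ := (add_comm _ _).le

/-- The minterms `x * y` through a fixed variable `x` are covered by as many reducts as `x` has
occurrences: for each of them some reduct drops a factor that is true at `y`. -/
theorem exists_covering_reducts (x : α) (φ : MonotoneFormula α) :
    ∃ L : List (MonotoneFormula α × MonotoneFormula α), L.length ≤ occurrences x φ ∧
      (∀ p ∈ L, IsReduct φ p) ∧
      ∀ y, Eval {x, y} φ → ¬ Eval {x} φ → ¬ Eval {y} φ → ∃ p ∈ L, Eval {y} p.2 := by
  induction φ with
  | var a =>
    refine ⟨[], Nat.zero_le _, by simp, fun y h hx hy => ?_⟩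
    rcases h with h | h
    exacts [(hx h).elim, (hy h).elim]
  | add φ₁ φ₂ ih₁ ih₂ =>
    obtain ⟨L₁, l₁, r₁, c₁⟩ := ih₁
    obtain ⟨L₂, l₂, r₂, c₂⟩ := ih₂
    refine ⟨L₁.map (fun p => (add p.1 φ₂, p.2)) ++ L₂.map (fun p => (add φ₁ p.1, p.2)),
      by simpa [occurrences] using add_le_add l₁ l₂, fun p hp => ?_, fun y h hx hy => ?_⟩
    · simp only [List.mem_append, List.mem_map] at hp
      rcases hp with ⟨q, hq, rfl⟩ | ⟨q, hq, rfl⟩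
      exacts [(r₁ q hq).add_left φ₂, (r₂ q hq).add_right φ₁]
    · simp only [Eval, not_or] at hx hy
      rcases h with h | h
      · obtain ⟨p, hp, hpy⟩ := c₁ y h hx.1 hy.1
        exact ⟨_, List.mem_append_left _ (List.mem_map_of_mem hp), hpy⟩
      · obtain ⟨p, hp, hpy⟩ := c₂ y h hx.2 hy.2
        exact ⟨_, List.mem_append_right _ (List.mem_map_of_mem hp), hpy⟩
  | mul φ₁ φ₂ ih₁ ih₂ =>
    obtain ⟨L₁, l₁, r₁, c₁⟩ := ih₁
    obtain ⟨L₂, l₂, r₂, c₂⟩ := ih₂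
    have r₁' : ∀ p ∈ L₁.map (fun p => (mul p.1 φ₂, p.2)), IsReduct (mul φ₁ φ₂) p := by
      intro p hp
      obtain ⟨q, hq, rfl⟩ := List.mem_map.1 hp
      exact (r₁ q hq).mul_left φ₂
    have r₂' : ∀ p ∈ L₂.map (fun p => (mul φ₁ p.1, p.2)), IsReduct (mul φ₁ φ₂) p := by
      intro p hp
      obtain ⟨q, hq, rfl⟩ := List.mem_map.1 hp
      exact (r₂ q hq).mul_right φ₁
    -- If `x` alone makes `φ₁` true, it occurs there, and that occurrence pays for the one reduct
    -- dropping `φ₂`; the list `L₁` is not needed.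
    by_cases hx₁ : Eval {x} φ₁
    · have := occurrences_pos_of_eval hx₁
      refine ⟨(φ₁, φ₂) :: L₂.map (fun p => (mul φ₁ p.1, p.2)), ?_, ?_, fun y h hx hy => ?_⟩
      · simp only [List.length_cons, List.length_map, occurrences]; omega
      · exact List.forall_mem_cons.2 ⟨isReduct_left φ₁ φ₂, r₂'⟩
      · by_cases hy₂ : Eval {y} φ₂
        · exact ⟨_, List.mem_cons_self, hy₂⟩
        · obtain ⟨p, hp, hpy⟩ := c₂ y h.2 (fun hx₂ => hx ⟨hx₁, hx₂⟩) hy₂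
          exact ⟨_, List.mem_cons_of_mem _ (List.mem_map_of_mem hp), hpy⟩
    by_cases hx₂ : Eval {x} φ₂
    · have := occurrences_pos_of_eval hx₂
      refine ⟨(φ₂, φ₁) :: L₁.map (fun p => (mul p.1 φ₂, p.2)), ?_, ?_, fun y h hx hy => ?_⟩
      · simp only [List.length_cons, List.length_map, occurrences]; omega
      · exact List.forall_mem_cons.2 ⟨isReduct_right φ₁ φ₂, r₁'⟩
      · by_cases hy₁ : Eval {y} φ₁
        · exact ⟨_, List.mem_cons_self, hy₁⟩
        · obtain ⟨p, hp, hpy⟩ := c₁ y h.1 hx₁ hy₁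
          exact ⟨_, List.mem_cons_of_mem _ (List.mem_map_of_mem hp), hpy⟩
    -- Now `x` makes neither factor true and `y` not both, so some factor is false at each alone and
    -- its list covers `y`.
    refine ⟨L₁.map (fun p => (mul p.1 φ₂, p.2)) ++ L₂.map (fun p => (mul φ₁ p.1, p.2)),
      by simpa [occurrences] using add_le_add l₁ l₂, ?_, fun y h hx hy => ?_⟩
    · exact List.forall_mem_append.2 ⟨r₁', r₂'⟩
    · by_cases hy₁ : Eval {y} φ₁
      · obtain ⟨p, hp, hpy⟩ := c₂ y h.2 hx₂ (fun hy₂ => hy ⟨hy₁, hy₂⟩)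
        exact ⟨_, List.mem_append_right _ (List.mem_map_of_mem hp), hpy⟩
      · obtain ⟨p, hp, hpy⟩ := c₁ y h.1 hx₁ hy₁
        exact ⟨_, List.mem_append_left _ (List.mem_map_of_mem hp), hpy⟩

end MonotoneFormula

open MonotoneFormula

/-! ### Extensions as Boolean functions -/

/-- The characterization of extensions of `G(n)` by the Boolean function of the formula. -/
structure RepresentsExtension (n : ℕ) (φ : MonotoneFormula (Fin n ⊕ Fin n)) : Prop where
  edge : ∀ i j, i ≤ j → Eval {Sum.inl i, Sum.inr j} φ
  not_singleton : ∀ v, ¬ Eval {v} φ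
  cases : ∀ S, Eval S φ → (∃ i j, i ≤ j ∧ Sum.inl i ∈ S ∧ Sum.inr j ∈ S) ∨
    Eval (S ∩ Set.range Sum.inl) φ ∨ Eval (S ∩ Set.range Sum.inr) φ

theorem IsExtension.representsExtension {n : ℕ} {φ : MonotoneFormula (Fin n ⊕ Fin n)}
    (h : IsExtension n φ) : RepresentsExtension n φ where
  edge i j hij := by
    have := eval_of_mem_csop (mem_csop_of_mem_sop
      (h.1 (Sum.inl i) (Sum.inr j) ⟨i, j, hij, Or.inl ⟨rfl, rfl⟩⟩))
    simpa using this
  not_singleton v hv := by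
    obtain ⟨t, ht, htv⟩ := exists_mem_sop_of_eval hv
    have hcard : t.card ≤ 1 := by
      have : t ⊆ {v} := by exact_mod_cast htv
      simpa using Finset.card_le_card this
    rcases h.2 t ht with ⟨u, w, huw, rfl⟩ | ⟨h2, -⟩ | ⟨h2, -⟩
    · rw [Finset.card_pair huw.ne] at hcard
      omega
    · omega
    · omega
  cases S hS := by
    obtain ⟨t, ht, htS⟩ := exists_mem_sop_of_eval hS
    have htE := eval_of_mem_csop (mem_csop_of_mem_sop ht)
    rcases h.2 t ht with ⟨u, w, ⟨i, j, hij, ⟨rfl, rfl⟩ | ⟨rfl, rfl⟩⟩, rfl⟩ | ⟨-, h2⟩ | ⟨-, h2⟩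
    · exact Or.inl ⟨i, j, hij, htS (by simp), htS (by simp)⟩
    · exact Or.inl ⟨i, j, hij, htS (by simp), htS (by simp)⟩
    · refine Or.inr (Or.inl (htE.mono ?_))
      intro v hv
      refine ⟨htS hv, ?_⟩
      obtain ⟨i, rfl⟩ := Sum.isLeft_iff.1 (h2 v hv)
      exact ⟨i, rfl⟩
    · refine Or.inr (Or.inr (htE.mono ?_))
      intro v hv
      refine ⟨htS hv, ?_⟩
      obtain ⟨i, rfl⟩ := Sum.isRight_iff.1 (h2 v hv)
      exact ⟨i, rfl⟩

theorem RepresentsExtension.two_le_card {n : ℕ} {φ : MonotoneFormula (Fin n ⊕ Fin n)}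
    (h : RepresentsExtension n φ) (hn : 1 ≤ n) {t : Finset (Fin n ⊕ Fin n)} (ht : t ∈ φ.csop) :
    2 ≤ t.card := by
  by_contra! hcard
  have : Nonempty (Fin n ⊕ Fin n) := ⟨Sum.inl ⟨0, hn⟩⟩
  obtain ⟨v, hv⟩ := Finset.card_le_one_iff_subset_singleton.1 (Nat.le_of_lt_succ hcard)
  exact h.not_singleton v ((eval_of_mem_csop ht).mono (by exact_mod_cast hv))

theorem RepresentsExtension.isExtension {n : ℕ} {φ : MonotoneFormula (Fin n ⊕ Fin n)}
    (h : RepresentsExtension n φ) (hn : 1 ≤ n) : IsExtension n φ := by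
  have hpair : ∀ u v, ∀ t ∈ φ.csop, t ⊆ {u, v} → t = {u, v} := fun u v t ht htuv =>
    Finset.eq_of_subset_of_card_le htuv (Finset.card_le_two.trans (h.two_le_card hn ht))
  have hmem : ∀ i j : Fin n, i ≤ j → {Sum.inl i, Sum.inr j} ∈ φ.csop := by
    intro i j hij
    obtain ⟨t, ht, htS⟩ := eval_iff_exists_mem_csop.1 (h.edge i j hij)
    rwa [← hpair _ _ t ht fun v hv => by simpa using htS hv]
  refine ⟨?_, fun t ht => ?_⟩
  · rintro u v ⟨i, j, hij, ⟨rfl, rfl⟩ | ⟨rfl, rfl⟩⟩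
    · exact mem_sop_iff.2 ⟨hmem i j hij, hpair _ _⟩
    · refine mem_sop_iff.2 ⟨?_, hpair _ _⟩
      rw [Finset.pair_comm]
      exact hmem i j hij
  · have htc := mem_csop_of_mem_sop ht
    rcases h.cases t (eval_of_mem_csop htc) with ⟨i, j, hij, hi, hj⟩ | hE | hE
    · refine Or.inl ⟨Sum.inl i, Sum.inr j, ⟨i, j, hij, Or.inl ⟨rfl, rfl⟩⟩, ?_⟩
      exact (eq_of_mem_sop ht (hmem i j hij) (by
        simp only [Finset.insert_subset_iff, Finset.singleton_subset_iff]
        exact ⟨hi, hj⟩)).symm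
    · obtain ⟨s, hs, hsS⟩ := eval_iff_exists_mem_csop.1 hE
      obtain rfl := eq_of_mem_sop ht hs fun v hv => (hsS hv).1
      refine Or.inr (Or.inl ⟨h.two_le_card hn htc, fun v hv => ?_⟩)
      obtain ⟨i, rfl⟩ := (hsS hv).2
      rfl
    · obtain ⟨s, hs, hsS⟩ := eval_iff_exists_mem_csop.1 hE
      obtain rfl := eq_of_mem_sop ht hs fun v hv => (hsS hv).1
      refine Or.inr (Or.inr ⟨h.two_le_card hn htc, fun v hv => ?_⟩)
      obtain ⟨i, rfl⟩ := (hsS hv).2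
      rfl

/-- Such a pair contains no edge, and its one-sided parts are single variables. -/
theorem RepresentsExtension.not_eval_of_lt {n : ℕ} {φ : MonotoneFormula (Fin n ⊕ Fin n)}
    (h : RepresentsExtension n φ) {i j : Fin n} (hij : j < i) :
    ¬ Eval {Sum.inl i, Sum.inr j} φ := by
  intro hE
  rcases h.cases _ hE with ⟨a, b, hab, ha, hb⟩ | hE | hE
  · obtain rfl : a = i := by simpa using ha
    obtain rfl : b = j := by simpa using hb
    exact absurd hab hij.not_ge
  · refine h.not_singleton (Sum.inl i) (hE.mono ?_)
    rintro _ ⟨hv, a, rfl⟩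
    simpa using hv
  · refine h.not_singleton (Sum.inr j) (hE.mono ?_)
    rintro _ ⟨hv, a, rfl⟩
    simpa using hv

/-- The symmetry of `G(n)` that exchanges the two sides and reverses the order. -/
theorem RepresentsExtension.exists_dual {n : ℕ} (hn : 1 ≤ n)
    {φ : MonotoneFormula (Fin n ⊕ Fin n)} (h : RepresentsExtension n φ) :
    ∃ ψ, RepresentsExtension n ψ ∧
      (∀ i, occurrences (Sum.inl i) ψ ≤ occurrences (Sum.inr i.rev) φ) ∧
      ∀ j, occurrences (Sum.inr j) ψ ≤ occurrences (Sum.inl j.rev) φ := by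
  set e : Fin n ⊕ Fin n → Fin n ⊕ Fin n := fun v => (Sum.map Fin.rev Fin.rev v).swap with he
  have hinv : ∀ v, e (e v) = v := by rintro (i | i) <;> simp [he]
  have hinj : Function.Injective e := Function.LeftInverse.injective hinv
  have hedge : ∀ i j : Fin n, i ≤ j → Eval (e '' {Sum.inl i, Sum.inr j}) φ := by
    intro i j hij
    have := h.edge j.rev i.rev (Fin.rev_le_rev.2 hij)
    rw [Set.image_pair, Set.pair_comm]
    simpa [he] using this
  rcases exists_restriction e hinj φ with h0 | ⟨ψ, hψ, ho⟩
  · exact absurd (hedge ⟨0, hn⟩ ⟨0, hn⟩ le_rfl) (h0 _)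
  refine ⟨ψ, ⟨fun i j hij => (hψ _).2 (hedge i j hij), fun v => ?_, fun S hS => ?_⟩,
    fun i => ho (Sum.inl i), fun j => ho (Sum.inr j)⟩
  · rw [hψ, Set.image_singleton]
    exact h.not_singleton _
  · rcases h.cases _ ((hψ S).1 hS) with ⟨i, j, hij, ⟨u, hu, hui⟩, v, hv, hvj⟩ | hE | hE
    · rw [← hinv u, hui] at hu
      rw [← hinv v, hvj] at hv
      exact Or.inl ⟨j.rev, i.rev, Fin.rev_le_rev.2 hij, hv, hu⟩
    · refine Or.inr (Or.inr ((hψ _).2 (hE.mono ?_)))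
      rintro _ ⟨⟨u, hu, hui⟩, i, rfl⟩
      refine ⟨u, ⟨hu, ?_⟩, hui⟩
      rw [← hinv u, hui]
      exact ⟨i.rev, rfl⟩
    · refine Or.inr (Or.inl ((hψ _).2 (hE.mono ?_)))
      rintro _ ⟨⟨u, hu, hui⟩, i, rfl⟩
      refine ⟨u, ⟨hu, ?_⟩, hui⟩
      rw [← hinv u, hui]
      exact ⟨i.rev, rfl⟩

/-! ### Saving an occurrence -/

/-- If each `x` variable occurs at most `q` times, passing from `G(m)` to `G(t)` with `t * q < m`
saves an occurrence of every `y` variable. -/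
theorem RepresentsExtension.exists_reduced {m t p q : ℕ} (ht : 1 ≤ t) (htm : t * q < m)
    {φ : MonotoneFormula (Fin m ⊕ Fin m)} (h : RepresentsExtension m φ)
    (hx : ∀ i, occurrences (Sum.inl i) φ ≤ q) (hy : ∀ j, occurrences (Sum.inr j) φ ≤ p) :
    ∃ ψ, RepresentsExtension t ψ ∧ (∀ i, occurrences (Sum.inl i) ψ ≤ q) ∧
      ∀ j, occurrences (Sum.inr j) ψ ≤ p - 1 := by
  classical
  have hm : 0 < m := by omega
  obtain ⟨L, hL, hred, hcov⟩ := exists_covering_reducts (Sum.inl ⟨0, hm⟩ : Fin m ⊕ Fin m) φ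
  have hcov' : ∀ j : Fin m, ∃ p ∈ L, Eval {Sum.inr j} p.2 := fun j =>
    hcov _ (h.edge _ _ (Nat.zero_le _)) (h.not_singleton _) (h.not_singleton _)
  choose c hcL hc using hcov'
  -- The fibre has at least t + 1 indices, one more than G(t) needs.
  obtain ⟨⟨ψ, w⟩, hpL, hcard⟩ := Finset.exists_lt_card_fiber_of_mul_lt_card_of_maps_to
    (s := (Finset.univ : Finset (Fin m))) (t := L.toFinset) (f := c) (n := t)
    (fun j _ => List.mem_toFinset.2 (hcL j)) (by
      rw [Finset.card_univ, Fintype.card_fin, mul_comm]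
      exact (Nat.mul_le_mul_left t (L.toFinset_card_le.trans (hL.trans (hx _)))).trans_lt htm)
  set g := Finset.orderEmbOfCardLe _ hcard with hg
  have hgw : ∀ s, Eval {Sum.inr (g s)} w := by
    intro s
    have hs := Finset.orderEmbOfCardLe_mem _ hcard s
    rw [← hg, Finset.mem_filter] at hs
    have := hc (g s)
    rwa [hs.2] at this
  have hR : IsReduct φ (ψ, w) := hred _ (List.mem_toFinset.1 hpL)
  -- The spare index `g 0` lies below all kept ones: if some kept x alone made `ψ` true, then with
  -- the y at `g 0` it would make `φ` true on a non-edge.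
  set f : Fin t → Fin m := fun s => g s.succ with hf
  have hfle : ∀ a b, f a ≤ f b ↔ a ≤ b := by simp [hf]
  have hfinj : Function.Injective f := fun a b hab =>
    le_antisymm ((hfle a b).1 hab.le) ((hfle b a).1 hab.ge)
  have hinj : Function.Injective (Sum.map f f) := Sum.map_injective.2 ⟨hfinj, hfinj⟩
  have hedge : ∀ i j : Fin t, i ≤ j → Eval (Sum.map f f '' {Sum.inl i, Sum.inr j}) ψ := by
    intro i j hij
    rw [Set.image_pair]
    exact hR.le _ (h.edge _ _ ((hfle i j).2 hij))
  rcases exists_restriction (Sum.map f f) hinj ψ with h0 | ⟨χ, hχ, ho⟩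
  · exact absurd (hedge ⟨0, ht⟩ ⟨0, ht⟩ le_rfl) (h0 _)
  refine ⟨χ, ⟨fun i j hij => (hχ _).2 (hedge i j hij), ?_, fun S hS => ?_⟩, fun i => ?_,
    fun j => ?_⟩
  · intro v hv
    rw [hχ, Set.image_singleton] at hv
    rcases v with i | j
    · have hlt : g 0 < f i := g.strictMono i.succ_pos
      exact h.not_eval_of_lt hlt
        (hR.ge _ (hv.mono (by simp)) ((hgw 0).mono (by simp)))
    · exact h.not_singleton _ (hR.ge _ hv (hgw _))
  · rw [hχ] at hS
    -- A true y forces `w`, so `φ` decides; without one, S is already one-sided.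
    by_cases hSy : ∃ j, Sum.inr j ∈ S
    · obtain ⟨j, hj⟩ := hSy
      have hwS : Eval (Sum.map f f '' S) w :=
        (hgw j.succ).mono (Set.singleton_subset_iff.2 (Set.mem_image_of_mem (Sum.map f f) hj))
      rcases h.cases _ (hR.ge _ hS hwS) with ⟨a, b, hab, ⟨u, hu, hua⟩, v, hv, hvb⟩ | hE | hE
      · rcases u with i | i <;> simp only [Sum.map_inl, Sum.map_inr, reduceCtorEq,
          Sum.inl.injEq] at hua
        rcases v with j | j <;> simp only [Sum.map_inl, Sum.map_inr, reduceCtorEq,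
          Sum.inr.injEq] at hvb
        subst hua hvb
        exact Or.inl ⟨i, j, (hfle i j).1 hab, hu, hv⟩
      · refine Or.inr (Or.inl ((hχ _).2 (hR.le _ (hE.mono ?_))))
        rintro _ ⟨⟨u | u, hu, rfl⟩, i, hi⟩
        · exact ⟨_, ⟨hu, u, rfl⟩, rfl⟩
        · simp at hi
      · refine Or.inr (Or.inr ((hχ _).2 (hR.le _ (hE.mono ?_))))
        rintro _ ⟨⟨u | u, hu, rfl⟩, i, hi⟩
        · simp at hi
        · exact ⟨_, ⟨hu, u, rfl⟩, rfl⟩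
    · refine Or.inr (Or.inl ((hχ _).2 (hS.mono (Set.image_mono ?_))))
      rintro (i | j) hv
      · exact ⟨hv, i, rfl⟩
      · exact absurd ⟨j, hv⟩ hSy
  · exact (ho _).trans ((Nat.le_add_right _ _).trans ((hR.occurrences_le _).trans (hx (f i))))
  · have h1 : 0 < occurrences (Sum.inr (f j)) w := occurrences_pos_of_eval (hgw _)
    have h2 : _ + occurrences (Sum.inr (f j)) w ≤ _ := hR.occurrences_le (Sum.inr (f j))
    have h3 := hy (f j)
    have h4 : _ ≤ occurrences (Sum.inr (f j)) ψ := ho (Sum.inr j)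
    simp only at h2
    omega

theorem HasReadExtension.pred {n k m : ℕ} (hn : 1 ≤ n) (hk : 1 ≤ k) (hm : 2 * n * k ^ k ≤ m)
    (h : HasReadExtension m k) : HasReadExtension n (k - 1) := by
  obtain ⟨φ, hφ, hread⟩ := h
  obtain ⟨l, rfl⟩ : ∃ l, k = l + 1 := ⟨k - 1, by omega⟩
  rw [Nat.add_sub_cancel]
  -- The two reductions go from m to T - 1 and then to n. They only need m > (n * l + 1) * (l + 1),
  -- so the bound is generous.
  set T := 2 * n * (l + 1) ^ l with hT
  have hTm : T * (l + 1) ≤ m := by rwa [hT, mul_assoc, ← pow_succ]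
  have hlT : n * l + 2 ≤ T := by
    rcases Nat.eq_zero_or_pos l with rfl | hl
    · simp only [hT]; omega
    · have h1 : l + 1 ≤ (l + 1) ^ l := Nat.le_self_pow hl.ne' _
      have h2 : 2 * n * (l + 1) ≤ T := Nat.mul_le_mul_left _ h1
      nlinarith
  have hlt : (T - 1) * (l + 1) < m :=
    (Nat.mul_lt_mul_of_pos_right (by omega) (Nat.succ_pos l)).trans_le hTm
  obtain ⟨φ₁, h₁, hx₁, hy₁⟩ := hφ.representsExtension.exists_reduced (by omega) hlt
    (fun i => hread (Sum.inl i)) (fun j => hread (Sum.inr j))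
  obtain ⟨φ₂, h₂, hx₂, hy₂⟩ := h₁.exists_dual (by omega)
  -- After dualizing, the x's already occur at most l times, so the pigeonhole factor is l and the
  -- y's drop from l + 1 to l.
  obtain ⟨φ₃, h₃, hx₃, hy₃⟩ := h₂.exists_reduced hn (show n * l < T - 1 by omega)
    (fun i => (hx₂ i).trans (hy₁ _)) (fun j => (hy₂ j).trans (hx₁ _))
  exact ⟨φ₃, h₃.isExtension hn, fun v => v.rec hx₃ hy₃⟩

theorem mainTheorem2 (n k : ℕ) (hn : 1 ≤ n) (hk : 1 ≤ k)
    (h : ¬ HasReadExtension n (k - 1)) :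
    (∃ m : ℕ, n < m ∧ ¬ HasReadExtension m k) ∧
      ∀ m : ℕ, 2 * n * k ^ k ≤ m → ¬ HasReadExtension m k := by
  have hlarge : ∀ m : ℕ, 2 * n * k ^ k ≤ m → ¬ HasReadExtension m k :=
    fun m hm hext => h (hext.pred hn hk hm)
  refine ⟨⟨2 * n * k ^ k, ?_, hlarge _ le_rfl⟩, hlarge⟩
  have : 0 < k ^ k := pow_pos hk k
  nlinarith
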